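/- **Conventions.** Let $\mu$ be a regular cardinal. A ($\mu$-ary) *abstract class* $\mathbf K=(K,\le)$ consists of a class $K$ of structures in a fixed $\mu$-ary vocabulary $\tau$ (all symbols have arity less than $\mu$) and a partial order $\le$ on $K$ refining the substructure relation $\subseteq$, both closed under isomorphism. We write $UM$ for the universe of $M$. $\mathbf K$ is a *$\mu$-AEC* if: 1. (coherence) $M_0\subseteq M_1\le M_2$ and $M_0\le M_2$ imply $M_0\le M_1$; 2. (chain axioms) if $\langle M_i\rangle_{i\in I}$ is a $\mu$-directed system in $\mathbf K$ and $M=\bigcup_{i\in I} M_i$, then $M\in K$, $M_i\le M$ for all $i$, and $M\le N$ whenever $M_i\le N$ for all $i$; 3. (Löwenheim–Skolem–Tarski) there is a cardinal $\theta=\theta^{<\mu}\ge|\tau|+\mu$ such that for every $M\in K$ and $A\subseteq UM$ there is $M_0\le M$ with $A\subseteq UM_0$ and $|UM_0|\le|A|^{<\mu}+\theta$. The least such $\theta$ is denoted $\mathrm{LS}(\mathbf K)$. A *$\mathbf K$-embedding* $f:M\to N$ is an isomorphism of $M$ onto a structure $f[M]\le N$. We view $\mathbf K$ as a category with the $\mathbf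 K$-embeddings as morphisms. For a cardinal $\lambda>\mathrm{LS}(\mathbf K)$, $M\in\mathbf K$ is *$\lambda$-model-homogeneous* if whenever $M_0\le M$, $M_0\le N_0$ and $|UN_0|<\lambda$, there is a $\mathbf K$-embedding $N_0\to M$ fixing $M_0$ pointwise. In a category $\mathcal K$, an *amalgam* of a span $(f_1:M_0\to M_1,\ f_2:M_0\to M_2)$ is a cospan $(g_1:M_1\to N,\ g_2:M_2\to N)$ with $g_1f_1=g_2f_2$. Two amalgams $(g_1,g_2)$ and $(g_1',g_2')$, with vertices $N$ and $N'$, of the same span are related by $\sim^*$ if there are $h:N\to N_*$ and $h':N'\to N_*$ with $hg_\ell=h'g'_\ell$ for $\ell=1,2$; $\sim$ is the transitive closure of $\sim^*$. An *independence relation* is a class of commutative squares $(f_1,f_2,g_1,g_2)$, called *independent*, closed under $\sim$ (for a fixed span). It is *symmetric* if $(f_1,f_2,g_1,g_2)$ is independent exactly when $(f_2,f_1,g_2,g_1)$ is; it has *existence* if every span has an independent amalgam; it has *uniqueness* if any two independent amalgams of the same span are $\sim$-related; it is *right transitive* if the horizontal composition of two independent squares is independent: if $(f_{01},f_{02},f_{13},f_{23})$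 and $(f_{23},f_{24},f_{35},f_{45})$ are independent, so is $(f_{01},f_{24}f_{02},f_{35}f_{13},f_{45})$. Given existence and right transitivity, let $\mathcal K_{\mathrm{NF}}$ be the category whose objects are the morphisms of $\mathcal K$ and whose morphisms from $f:M_1\to M_2$ to $g:N_1\to N_2$ are the pairs $(h_1:M_1\to N_1,\ h_2:M_2\to N_2)$ such that the square $(f,h_1,h_2,g)$ is independent; the relation is *right accessible* if $\mathcal K_{\mathrm{NF}}$ is an accessible category. The left versions are the right versions for the dual relation $\{(f_1,f_2,g_1,g_2):(f_2,f_1,g_2,g_1)\text{ independent}\}$. An independence relation is *stable* if it is symmetric, left and right transitive, left and right accessible, and has existence and uniqueness. In an abstract class, *$M_1$ and $M_2$ are independent over $M_0$ inside $M_3$* means that $M_0\le M_\ell\le M_3$ for $\ell=1,2$ and that the square formed by the four inclusions is independent. **Theorem.** Let $\mathbf K$ be a $\mu$-AEC with a stable independence relation. There is a regular cardinal $\lambda>\mathrm{LS}(\mathbf K)$ such that: - whenever $M_1$ and $M_2$ are independent over $M_0$ inside $M_3$ and $M_0$ is $\lambda$-model-homogeneous, $UM_1\cap UM_2=UM_0$;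 - consequently, every independent square $(f_1:M_0\to M_1,\ f_2:M_0\to M_2,\ g_1:M_1\to M_3,\ g_2:M_2\to M_3)$ of $\mathbf K$-embeddings with $M_0$ $\lambda$-model-homogeneous is a pullback square in the category $\mathbf K$. -/

import Mathlib

open CategoryTheory CategoryTheory.Limits Cardinal

universe u v w

noncomputable section

/-! ## Independence relations on an arbitrary category -/

namespace StableIndep

section General

variable {C : Type v} [Category.{w} C]

/-- An amalgam of the span `(f₁, f₂)`: a cospan completing it to a commutative square. -/
structure Amalgam {M₀ M₁ M₂ : C} (f₁ : M₀ ⟶ M₁) (f₂ : M₀ ⟶ M₂) where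
  pt : C
  inl : M₁ ⟶ pt
  inr : M₂ ⟶ pt
  comm : f₁ ≫ inl = f₂ ≫ inr

/-- The relation `∼*` on amalgams of a fixed span: the two amalgams embed, compatibly with
`M₁` and `M₂`, in a common object. -/
def Amalgam.SimStar {M₀ M₁ M₂ : C} {f₁ : M₀ ⟶ M₁} {f₂ : M₀ ⟶ M₂} (a b : Amalgam f₁ f₂) : Prop :=
  ∃ (N : C) (ga : a.pt ⟶ N) (gb : b.pt ⟶ N), a.inl ≫ ga = b.inl ≫ gb ∧ a.inr ≫ ga = b.inr ≫ gb

/-- The relation `∼`: the transitive closure of `∼*`. -/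
def Amalgam.Sim {M₀ M₁ M₂ : C} {f₁ : M₀ ⟶ M₁} {f₂ : M₀ ⟶ M₂} (a b : Amalgam f₁ f₂) : Prop :=
  Relation.TransGen Amalgam.SimStar a b

variable (C) in
/-- An independence relation on `C`: a class of commutative squares
(written as `(f₁, f₂, g₁, g₂)` with `f₁ ≫ g₁ = f₂ ≫ g₂`) closed under `∼`. -/
@[ext]
structure IndepRel where
  Indep : ∀ {M₀ M₁ M₂ N : C}, (M₀ ⟶ M₁) → (M₀ ⟶ M₂) → (M₁ ⟶ N) → (M₂ ⟶ N) → Prop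
  comm : ∀ {M₀ M₁ M₂ N : C} {f₁ : M₀ ⟶ M₁} {f₂ : M₀ ⟶ M₂} {g₁ : M₁ ⟶ N} {g₂ : M₂ ⟶ N},
    Indep f₁ f₂ g₁ g₂ → f₁ ≫ g₁ = f₂ ≫ g₂
  closed : ∀ {M₀ M₁ M₂ : C} {f₁ : M₀ ⟶ M₁} {f₂ : M₀ ⟶ M₂} (a b : Amalgam f₁ f₂),
    a.Sim b → Indep f₁ f₂ a.inl a.inr → Indep f₁ f₂ b.inl b.inr

namespace IndepRel

/-- The dual independence relation, with the two sides exchanged. -/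
def dual (I : IndepRel C) : IndepRel C where
  Indep f₁ f₂ g₁ g₂ := I.Indep f₂ f₁ g₂ g₁
  comm h := (I.comm h).symm
  closed {M₀ M₁ M₂ f₁ f₂} a b hab h := by
    let sw : Amalgam f₁ f₂ → Amalgam f₂ f₁ := fun a => ⟨a.pt, a.inr, a.inl, a.comm.symm⟩
    have hsw : ∀ x y, x.SimStar y → (sw x).SimStar (sw y) := fun x y ⟨N, ga, gb, h1, h2⟩ =>
      ⟨N, ga, gb, h2, h1⟩
    refine I.closed (sw a) (sw b) (Relation.TransGen.lift sw hsw _ _ hab) h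

def Symmetric (I : IndepRel C) : Prop := I = I.dual

/-- Existence: every span has an independent amalgam. -/
def HasExistence (I : IndepRel C) : Prop :=
  ∀ {M₀ M₁ M₂ : C} (f₁ : M₀ ⟶ M₁) (f₂ : M₀ ⟶ M₂),
    ∃ a : Amalgam f₁ f₂, I.Indep f₁ f₂ a.inl a.inr

/-- Uniqueness: any two independent amalgams of a span are equivalent. -/
def HasUniqueness (I : IndepRel C) : Prop :=
  ∀ {M₀ M₁ M₂ : C} {f₁ : M₀ ⟶ M₁} {f₂ : M₀ ⟶ M₂} (a b : Amalgam f₁ f₂),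
    I.Indep f₁ f₂ a.inl a.inr → I.Indep f₁ f₂ b.inl b.inr → a.Sim b

/-- Right transitivity: independent squares are closed under horizontal composition. -/
def RightTransitive (I : IndepRel C) : Prop :=
  ∀ {M₀ M₁ M₂ M₃ M₄ M₅ : C} {f₀₁ : M₀ ⟶ M₁} {f₀₂ : M₀ ⟶ M₂} {f₁₃ : M₁ ⟶ M₃} {f₂₃ : M₂ ⟶ M₃}
    {f₂₄ : M₂ ⟶ M₄} {f₃₅ : M₃ ⟶ M₅} {f₄₅ : M₄ ⟶ M₅},
    I.Indep f₀₁ f₀₂ f₁₃ f₂₃ → I.Indep f₂₃ f₂₄ f₃₅ f₄₅ →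
      I.Indep f₀₁ (f₀₂ ≫ f₂₄) (f₁₃ ≫ f₃₅) f₄₅

def LeftTransitive (I : IndepRel C) : Prop := I.dual.RightTransitive

/-- The class of morphisms of arrows of `C` which are independent squares. -/
def nf (I : IndepRel C) : MorphismProperty (Arrow C) :=
  fun f g h => I.Indep f.hom h.left h.right g.hom

theorem nf_isMultiplicative {I : IndepRel C} (hT : I.RightTransitive) (hE : I.HasExistence) :
    I.nf.IsMultiplicative where
  id_mem f := by
    obtain ⟨a, ha⟩ := hE f.hom (𝟙 f.left)
    have hc := a.comm
    refine I.closed a ⟨f.right, 𝟙 f.right, f.hom, by simp⟩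
      (Relation.TransGen.single ⟨a.pt, 𝟙 _, a.inl, by simp, ?_⟩) ha
    simpa using hc.symm
  comp_mem _ _ hf hg := hT hf hg

/-- The category `C_NF`: its objects are the morphisms of `C`, its morphisms are the independent
squares between them. It is a category as soon as `I` is right transitive with existence. -/
abbrev NF (I : IndepRel C) (hT : I.RightTransitive) (hE : I.HasExistence) : Type (max v w) :=
  haveI := nf_isMultiplicative hT hE
  WideSubcategory I.nf

instance (I : IndepRel C) (hT : I.RightTransitive) (hE : I.HasExistence) :
    Category (I.NF hT hE) :=
  haveI := nf_isMultiplicative hT hE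
  inferInstanceAs (Category (WideSubcategory I.nf))

/-- Right accessibility: `I` is right transitive and `C_NF` is an accessible category, where
sets are the types in `Type u`. -/
def RightAccessible (I : IndepRel C) : Prop :=
  ∃ (hT : I.RightTransitive) (hE : I.HasExistence), IsAccessibleCategory.{u} (I.NF hT hE)

/-- Stable independence relations (relative to the universe `u` of small sets). -/
structure IsStable (I : IndepRel C) : Prop where
  symmetric : I.Symmetric
  rightTransitive : I.RightTransitive
  leftTransitive : I.LeftTransitive
  rightAccessible : RightAccessible.{u} I
  leftAccessible : RightAccessible.{u} I.dual
  existence : I.HasExistence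
  uniqueness : I.HasUniqueness

end IndepRel

end General

/-! ## Structures in a `μ`-ary vocabulary -/

/-- A `μ`-ary vocabulary: a set of function symbols and a set of relation symbols, each with an
arity (an index set) of cardinality less than `μ`. -/
structure Vocabulary (μ : Cardinal.{u}) : Type (u + 1) where
  Fn : Type u
  Rl : Type u
  fnArity : Fn → Type u
  rlArity : Rl → Type u
  fnArity_lt : ∀ s, #(fnArity s) < μ
  rlArity_lt : ∀ r, #(rlArity r) < μ

/-- The cardinality of a vocabulary. -/
def Vocabulary.card {μ : Cardinal.{u}} (τ : Vocabulary μ) : Cardinal.{u} := #τ.Fn + #τ.Rl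

/-- A `τ`-structure. Its universe is a (small) set of sets, so that one structure can literally be
contained in another one, and unions and intersections are literal too. -/
structure Str {μ : Cardinal.{u}} (τ : Vocabulary μ) : Type (u + 1) where
  carrier : Set ZFSet.{u}
  small : Small.{u} carrier
  fn : ∀ s : τ.Fn, (τ.fnArity s → carrier) → carrier
  rl : ∀ r : τ.Rl, (τ.rlArity r → carrier) → Prop

attribute [instance] Str.small

namespace Str

variable {μ : Cardinal.{u}} {τ : Vocabulary μ}

/-- The cardinality of the universe of `M`. -/
def card (M : Str τ) : Cardinal.{u} := #(Shrink.{u} M.carrier)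

/-- `M` is a `τ`-substructure of `N`. -/
def IsSubstr (M N : Str τ) : Prop :=
  ∃ h : M.carrier ⊆ N.carrier,
    (∀ s x, N.fn s (fun i => Set.inclusion h (x i)) = Set.inclusion h (M.fn s x)) ∧
    (∀ r x, N.rl r (fun i => Set.inclusion h (x i)) ↔ M.rl r x)

/-- Isomorphisms of `τ`-structures. -/
structure Iso (M N : Str τ) extends M.carrier ≃ N.carrier where
  map_fn : ∀ s x, toFun (M.fn s x) = N.fn s (fun i => toFun (x i))
  map_rl : ∀ r x, M.rl r x ↔ N.rl r (fun i => toFun (x i))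

def Iso.refl (M : Str τ) : Iso M M where
  toEquiv := Equiv.refl _
  map_fn _ _ := rfl
  map_rl _ _ := Iff.rfl

def Iso.trans {M N P : Str τ} (e : Iso M N) (e' : Iso N P) : Iso M P where
  toEquiv := e.toEquiv.trans e'.toEquiv
  map_fn s x := by
    have h1 := e.map_fn s x
    have h2 := e'.map_fn s (fun i => e.toFun (x i))
    simp only [Equiv.toFun_as_coe, Equiv.trans_apply] at *
    rw [h1, h2]
  map_rl r x := (e.map_rl r x).trans (e'.map_rl r _)

/-- The copy of `M` along a bijection of its universe with a set of sets. -/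
def transport (M : Str τ) {S : Set ZFSet.{u}} (e : M.carrier ≃ S) : Str τ where
  carrier := S
  small := small_of_injective e.symm.injective
  fn s x := e (M.fn s fun i => e.symm (x i))
  rl r x := M.rl r fun i => e.symm (x i)

def transportIso (M : Str τ) {S : Set ZFSet.{u}} (e : M.carrier ≃ S) : Iso M (M.transport e) where
  toEquiv := e
  map_fn s x := by simp [transport]
  map_rl r x := by simp [transport]

/-- `M` is the union of the structures `F i`: its universe is the union of theirs, and it extends
each of them. -/
def IsUnion {ι : Type u} (M : Str τ) (F : ι → Str τ) : Prop :=
  M.carrier = ⋃ i, (F i).carrier ∧ ∀ i, (F i).IsSubstr M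

end Str

/-! ## Abstract classes and `μ`-AECs -/

/-- A `μ`-ary abstract class `(K, ≤)` in the vocabulary `τ`: a class of `τ`-structures with a
partial order refining the substructure relation, both closed under isomorphism. -/
structure AbstractClass {μ : Cardinal.{u}} (τ : Vocabulary μ) where
  Mem : Str τ → Prop
  Le : Str τ → Str τ → Prop
  mem_left : ∀ {M N}, Le M N → Mem M
  mem_right : ∀ {M N}, Le M N → Mem N
  le_refl : ∀ {M}, Mem M → Le M M
  le_trans : ∀ {M N P}, Le M N → Le N P → Le M P
  le_antisymm : ∀ {M N}, Le M N → Le N M → M = N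
  isSubstr_of_le : ∀ {M N}, Le M N → M.IsSubstr N
  mem_of_iso : ∀ {M N}, M.Iso N → Mem M → Mem N
  /-- If `e : N ≅ N'` maps `M` onto `M'` and `M ≤ N`, then `M' ≤ N'`. -/
  le_of_iso : ∀ {M N M' N' : Str τ} (d : M.Iso M') (e : N.Iso N'),
    (∀ (x : M.carrier) (y : N.carrier), (x : ZFSet) = y → (d.toFun x : ZFSet) = e.toFun y) →
    Le M N → Le M' N'

namespace AbstractClass

variable {μ : Cardinal.{u}} {τ : Vocabulary μ} (K : AbstractClass τ)

/-- The members of the class. -/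
structure Model where
  str : Str τ
  mem : K.Mem str

variable {K} in
/-- The universe of a member of the class. -/
abbrev Model.carrier (M : K.Model) : Set ZFSet.{u} := M.str.carrier

/-- `M ≤ N` in the abstract class. -/
instance : LE K.Model := ⟨fun M N => K.Le M.str N.str⟩

/-- A `K`-embedding `f : M → N`: an isomorphism of `M` onto a structure `f[M] ≤ N`. -/
def IsEmbedding (M N : K.Model) (f : M.carrier → N.carrier) : Prop :=
  ∃ M' : Str τ, K.Le M' N.str ∧
    ∃ e : M.str.Iso M', ∀ x, (f x : ZFSet) = e.toFun x

/-- The `K`-embeddings from `M` to `N`. -/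
@[ext]
structure Hom (M N : K.Model) where
  toFun : M.carrier → N.carrier
  isEmbedding : K.IsEmbedding M N toFun

variable {K}

theorem isEmbedding_incl {M N : K.Model} (h : M ≤ N) :
    K.IsEmbedding M N (Set.inclusion (K.isSubstr_of_le h).1) :=
  ⟨M.str, h, Str.Iso.refl _, fun _ => rfl⟩

theorem IsEmbedding.comp {M N P : K.Model} {f : M.carrier → N.carrier} {g : N.carrier → P.carrier}
    (hf : K.IsEmbedding M N f) (hg : K.IsEmbedding N P g) :
    K.IsEmbedding M P (g ∘ f) := by
  obtain ⟨M', hM', d, hd⟩ := hf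
  obtain ⟨N', hN', e, he⟩ := hg
  have hsub := (K.isSubstr_of_le hM').1
  let j : M'.carrier → ZFSet := fun x => (e.toFun (Set.inclusion hsub x) : ZFSet)
  have hj : Function.Injective j := fun x y hxy =>
    Set.inclusion_injective hsub (e.toEquiv.injective (Subtype.ext hxy))
  let q := Equiv.ofInjective j hj
  refine ⟨M'.transport q, K.le_trans (K.le_of_iso (M'.transportIso q) e ?_ hM') hN',
    d.trans (M'.transportIso q), ?_⟩
  · intro x y hxy
    have : Set.inclusion hsub x = y := Subtype.ext hxy
    subst this
    rfl
  · intro x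
    have : f x = Set.inclusion hsub (d.toFun x) := Subtype.ext (hd x)
    change (g (f x) : ZFSet) = e.toFun (Set.inclusion hsub (d.toFun x))
    rw [he, this]

/-- The category of members of `K` and `K`-embeddings. -/
instance : Category K.Model where
  Hom M N := K.Hom M N
  id M := ⟨id, isEmbedding_incl (K.le_refl M.mem)⟩
  comp f g := ⟨g.toFun ∘ f.toFun, f.isEmbedding.comp g.isEmbedding⟩

/-- The inclusion of `M` in `N` as a `K`-embedding, when `M ≤ N`. -/
def incl {M N : K.Model} (h : M ≤ N) : M ⟶ N :=
  Hom.mk (Set.inclusion (K.isSubstr_of_le h).1) (isEmbedding_incl h)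

/-- Every subset of `ι` of cardinality less than `μ` has an upper bound. -/
def IsDirectedCard (μ : Cardinal.{u}) (ι : Type u) [PartialOrder ι] : Prop :=
  ∀ s : Set ι, #s < μ → ∃ j, ∀ i ∈ s, i ≤ j

variable (K)

/-- `θ` witnesses the Löwenheim-Skolem-Tarski axiom: `θ = θ^{<μ} ≥ |τ| + μ`, and every subset `A`
of a member `M` is contained in some `M₀ ≤ M` of cardinality at most `|A|^{<μ} + θ`. -/
def IsLST (θ : Cardinal.{u}) : Prop :=
  θ = θ ^< μ ∧ τ.card + μ ≤ θ ∧
    ∀ (M : K.Model) (A : Set M.carrier), ∃ M₀ : K.Model, M₀ ≤ M ∧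
      (∀ x ∈ A, (x : ZFSet) ∈ M₀.carrier) ∧ M₀.str.card ≤ (#(Shrink.{u} A)) ^< μ + θ

/-- An abstract class in a `μ`-ary vocabulary is a `μ`-AEC. -/
structure IsMuAEC : Prop where
  coherence : ∀ {M₀ M₁ M₂ : K.Model}, M₀.str.IsSubstr M₁.str → M₁ ≤ M₂ → M₀ ≤ M₂ → M₀ ≤ M₁
  union_mem : ∀ {ι : Type u} [PartialOrder ι], IsDirectedCard μ ι →
    ∀ F : ι → K.Model, (∀ i j, i ≤ j → F i ≤ F j) →
    ∀ M : Str τ, M.IsUnion (fun i => (F i).str) → K.Mem M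
  le_union : ∀ {ι : Type u} [PartialOrder ι], IsDirectedCard μ ι →
    ∀ F : ι → K.Model, (∀ i j, i ≤ j → F i ≤ F j) →
    ∀ M : K.Model, M.str.IsUnion (fun i => (F i).str) → ∀ i, F i ≤ M
  union_le : ∀ {ι : Type u} [PartialOrder ι], IsDirectedCard μ ι →
    ∀ F : ι → K.Model, (∀ i j, i ≤ j → F i ≤ F j) →
    ∀ M : K.Model, M.str.IsUnion (fun i => (F i).str) →
    ∀ N : K.Model, (∀ i, F i ≤ N) → M ≤ N
  lst : ∃ θ, K.IsLST θ

/-- The Löwenheim-Skolem-Tarski number `LS(K)`. -/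
def LS : Cardinal.{u} := sInf {θ | K.IsLST θ}

variable {K}

/-- `M` is `κ`-model-homogeneous: whenever `M₀ ≤ M` and `M₀ ≤ N₀` with `|N₀| < κ`, some
`K`-embedding of `N₀` in `M` fixes `M₀` pointwise. -/
def IsModelHomogeneous (κ : Cardinal.{u}) (M : K.Model) : Prop :=
  ∀ M₀ N₀ : K.Model, M₀ ≤ M → M₀ ≤ N₀ → N₀.str.card < κ →
    ∃ f : K.Hom N₀ M, ∀ x : N₀.carrier, (x : ZFSet) ∈ M₀.carrier → (f.toFun x : ZFSet) = x

/-- `M₁` and `M₂` are independent over `M₀` inside `M₃`: `M₀ ≤ M₁, M₂ ≤ M₃` and the square of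
inclusions is independent. -/
def IndepIn (I : IndepRel K.Model) (M₀ M₁ M₂ M₃ : K.Model) : Prop :=
  ∃ (h₀₁ : M₀ ≤ M₁) (h₀₂ : M₀ ≤ M₂) (h₁₃ : M₁ ≤ M₃) (h₂₃ : M₂ ≤ M₃),
    I.Indep (incl h₀₁) (incl h₀₂) (incl h₁₃) (incl h₂₃)

end AbstractClass

end StableIndep

end

/-! Disjointness comes from comparing two independent amalgams of one small span. Right
accessibility yields local character (`exists_small_cover`): for a fixed small family of arrows,
every `y` in the target of any arrow is in the image of an independent square from a member of the
family. Suppose `y ∈ M₁` and `z ∈ M₂` agree in `M₃`. Cover `y` by a small arrow `A₀ ⟶ A₁` lying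
independently over `f₁`, and choose a small `N ≤ M₂` containing `z` and the image of `A₀`.
Transitivity and monotonicity make `A₁` and `N` independent over `A₀` in `M₃`. Homogeneity of `M₀`
embeds `N` in `M₀` over `A₀`, so the square over `f₁` gives a second independent amalgam of the same
span, in `M₁`. By uniqueness the two amalgams are equivalent, and since embeddings are injective,
equivalent amalgams identify the same elements (`sim_identifies`). Hence `y` is the image of an
element of `M₀`.

The work lies in local character, because colimits in `C_NF` need not be unions. The proof of
`exists_small_cover` gets around this with an endomorphism of the arrow that fixes the images of all
small pieces and sends everything into their union. -/

namespace StableIndep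

/-! ### Monotonicity and cancellation for independent squares. -/

namespace IndepRel

section General

variable {C : Type v} [Category.{w} C] {I : IndepRel C}

/-- Independence does not depend on the ambient object. -/
theorem indep_of_comp {M₀ M₁ M₂ N N' : C} {f₁ : M₀ ⟶ M₁} {f₂ : M₀ ⟶ M₂} {g₁ : M₁ ⟶ N}
    {g₂ : M₂ ⟶ N} {k : N ⟶ N'} (hc : f₁ ≫ g₁ = f₂ ≫ g₂)
    (h : I.Indep f₁ f₂ (g₁ ≫ k) (g₂ ≫ k)) : I.Indep f₁ f₂ g₁ g₂ :=
  I.closed ⟨N', g₁ ≫ k, g₂ ≫ k, I.comm h⟩ ⟨N, g₁, g₂, hc⟩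
    (.single ⟨N', 𝟙 _, k, by simp, by simp⟩) h

/-- Right monotonicity. -/
theorem indep_right_mono (hT : I.RightTransitive) (hE : I.HasExistence) (hU : I.HasUniqueness)
    {M₀ M₁ M₂ M₂' N : C} {f₁ : M₀ ⟶ M₁} {a : M₀ ⟶ M₂'} {b : M₂' ⟶ M₂} {g₁ : M₁ ⟶ N}
    {g₂ : M₂ ⟶ N} (h : I.Indep f₁ (a ≫ b) g₁ g₂) : I.Indep f₁ a g₁ (b ≫ g₂) := by
  -- An independent amalgam of `(f₁, a ≫ b)` is built in two stages, so its restriction along `b` is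
  -- independent. Uniqueness equates it with the given amalgam, and restriction along `b` preserves
  -- `∼`.
  obtain ⟨A, hA⟩ := hE f₁ a
  obtain ⟨B, hB⟩ := hE A.inr b
  let r : Amalgam f₁ (a ≫ b) → Amalgam f₁ a := fun x =>
    ⟨x.pt, x.inl, b ≫ x.inr, by rw [x.comm, Category.assoc]⟩
  have hr : ∀ x y, x.SimStar y → (r x).SimStar (r y) := fun x y ⟨Q, ga, gb, h1, h2⟩ =>
    ⟨Q, ga, gb, h1, by simp [r, h2]⟩
  have hAB : I.Indep f₁ (a ≫ b) (A.inl ≫ B.inl) B.inr := hT hA hB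
  let x : Amalgam f₁ (a ≫ b) := ⟨B.pt, A.inl ≫ B.inl, B.inr, I.comm hAB⟩
  let y : Amalgam f₁ (a ≫ b) := ⟨N, g₁, g₂, I.comm h⟩
  refine I.closed (r x) (r y) (Relation.TransGen.lift r hr _ _ (hU x y hAB h)) ?_
  refine I.closed A (r x) (.single ⟨B.pt, B.inl, 𝟙 _, by simp [r, x], ?_⟩) hA
  simpa [r, x] using B.comm

/-- The class `nf` is left cancellative. -/
theorem nf_of_comp (hT : I.RightTransitive) (hE : I.HasExistence) (hU : I.HasUniqueness)
    {X N M : Arrow C} (h : X ⟶ N) (j : N ⟶ M) (hj : I.nf (h ≫ j)) : I.nf h := by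
  -- The square `j` need only commute: its target side is absorbed by enlarging the ambient object,
  -- its source side by monotonicity.
  refine indep_of_comp (k := j.right) h.w.symm ?_
  have := indep_right_mono hT hE hU (I := I) (f₁ := X.hom) (a := h.left) (b := j.left)
    (g₁ := h.right ≫ j.right) (g₂ := M.hom) hj
  rwa [Arrow.w] at this

end General

end IndepRel

/-! ### Images and factorizations of `K`-embeddings. -/

/-- The inverse of an isomorphism of structures. -/
def Str.Iso.symm {μ : Cardinal.{u}} {τ : Vocabulary μ} {M N : Str τ} (e : M.Iso N) : N.Iso M where
  toEquiv := e.toEquiv.symm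
  map_fn s x := e.toEquiv.injective (by
    have := e.map_fn s fun i => e.toEquiv.symm (x i)
    simp only [Equiv.toFun_as_coe, Equiv.apply_symm_apply] at *
    exact this.symm)
  map_rl r x := by
    have := e.map_rl r fun i => e.toEquiv.symm (x i)
    simp only [Equiv.toFun_as_coe, Equiv.apply_symm_apply] at *
    exact this.symm

namespace AbstractClass

variable {μ : Cardinal.{u}} {τ : Vocabulary μ} {K : AbstractClass τ}

theorem hom_ext {M N : K.Model} {f g : M ⟶ N} (h : ∀ x, f.toFun x = g.toFun x) : f = g :=
  Hom.ext (funext h)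

theorem comp_toFun {M N P : K.Model} (f : M ⟶ N) (g : N ⟶ P) (x : M.carrier) :
    (f ≫ g).toFun x = g.toFun (f.toFun x) := rfl

theorem Hom.injective {M N : K.Model} (f : K.Hom M N) : Function.Injective f.toFun := by
  obtain ⟨M', h, e, he⟩ := f.isEmbedding
  intro x y hxy
  exact e.toEquiv.injective (Subtype.ext (by
    have := congrArg (fun z : N.carrier => (z : ZFSet)) hxy
    simpa [he] using this))

instance {M N : K.Model} (f : M ⟶ N) : Mono f where
  right_cancellation _ _ h := hom_ext fun x =>
    Hom.injective f (congrArg (fun k => Hom.toFun k x) h)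

/-- An isomorphism of structures, as a `K`-embedding. -/
def homOfStrIso {M N : K.Model} (e : M.str.Iso N.str) : M ⟶ N :=
  Hom.mk e.toFun ⟨N.str, K.le_refl N.mem, e, fun _ => rfl⟩

/-- An isomorphism of structures, as an isomorphism in the category of models. -/
def isoOfStrIso {M N : K.Model} (e : M.str.Iso N.str) : M ≅ N where
  hom := homOfStrIso e
  inv := homOfStrIso e.symm
  hom_inv_id := hom_ext fun x => e.toEquiv.symm_apply_apply x
  inv_hom_id := hom_ext fun x => e.toEquiv.apply_symm_apply x

/-- The image of a `K`-embedding. -/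
theorem exists_image {M N : K.Model} (f : M ⟶ N) : ∃ (M' : K.Model) (h : M' ≤ N)
    (e : M.str.Iso M'.str), homOfStrIso e ≫ incl h = f ∧
      M'.carrier = Set.range fun x => (f.toFun x : ZFSet) := by
  obtain ⟨S, h, e, he⟩ := f.isEmbedding
  refine ⟨⟨S, K.mem_left h⟩, h, e, hom_ext fun x => Subtype.ext (he x).symm, ?_⟩
  ext z
  constructor
  · intro hz
    exact ⟨e.toEquiv.symm ⟨z, hz⟩, by simp [he]⟩
  · rintro ⟨x, rfl⟩
    simp only [he]
    exact Subtype.property _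

/-- By coherence only `A ⊆ B` as structures is needed, and both inherit their operations and
relations from `C`. -/
theorem le_of_subset (hK : K.IsMuAEC) {A B C : K.Model} (hA : A ≤ C) (hB : B ≤ C)
    (h : A.carrier ⊆ B.carrier) : A ≤ B := by
  refine hK.coherence ?_ hB hA
  obtain ⟨h1, h2, h3⟩ := K.isSubstr_of_le hA
  obtain ⟨k1, k2, k3⟩ := K.isSubstr_of_le hB
  refine ⟨h, fun s x => ?_, fun r x => ?_⟩
  · apply Set.inclusion_injective k1
    rw [← k2]
    exact h2 s x
  · rw [← k3]
    exact h3 r x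

/-- A `K`-embedding factors through another one as soon as its range does. -/
theorem exists_lift (hK : K.IsMuAEC) {A B C : K.Model} (f : A ⟶ C) (g : B ⟶ C)
    (h : Set.range f.toFun ⊆ Set.range g.toFun) : ∃ l : A ⟶ B, l ≫ g = f := by
  obtain ⟨A', hA, e, he, hA'⟩ := exists_image f
  obtain ⟨B', hB, d, hd, hB'⟩ := exists_image g
  have hs : A'.carrier ⊆ B'.carrier := by
    rw [hA', hB']
    rintro _ ⟨x, rfl⟩
    obtain ⟨y, hy⟩ := h ⟨x, rfl⟩
    exact ⟨y, congrArg Subtype.val hy⟩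
  have hAB : A' ≤ B' := le_of_subset hK hA hB hs
  refine ⟨homOfStrIso e ≫ incl hAB ≫ (isoOfStrIso d).inv, ?_⟩
  rw [← hd, ← he]
  have : (isoOfStrIso d).inv ≫ homOfStrIso d = 𝟙 _ := (isoOfStrIso d).inv_hom_id
  simp only [Category.assoc, reassoc_of% this]
  rfl

end AbstractClass

end StableIndep

/-! ### Directed unions inside a model, and homogeneity along embeddings. -/

namespace StableIndep

namespace AbstractClass

variable {μ : Cardinal.{u}} {τ : Vocabulary μ} {K : AbstractClass τ}

/-- The union of a `μ`-directed system of strong submodels of a model. -/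
theorem exists_union_le (hK : K.IsMuAEC) {ι : Type u} [PartialOrder ι] (hι : IsDirectedCard μ ι)
    (F : ι → K.Model) (hF : ∀ i j, i ≤ j → F i ≤ F j) (M : K.Model) (hM : ∀ i, F i ≤ M) :
    ∃ N : K.Model, N ≤ M ∧ N.carrier = ⋃ i, (F i).carrier := by
  have hs i : (F i).carrier ⊆ M.carrier := (K.isSubstr_of_le (hM i)).1
  have hsub : (⋃ i, (F i).carrier) ⊆ M.carrier := Set.iUnion_subset hs
  -- A tuple of length less than `μ` from the union already lies in a single `F i`, so the union is
  -- closed under the functions of `M`.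
  have key {α : Type u} (hα : #α < μ) (x : α → ↥(⋃ i, (F i).carrier)) :
      ∃ i, ∀ a, (x a : ZFSet) ∈ (F i).carrier := by
    choose i hi using fun a => Set.mem_iUnion.1 (x a).2
    obtain ⟨j, hj⟩ := hι (Set.range i) (mk_range_le.trans_lt hα)
    exact ⟨j, fun a => (K.isSubstr_of_le (hF _ _ (hj _ ⟨a, rfl⟩))).1 (hi a)⟩
  have hfn (s : τ.Fn) (x : τ.fnArity s → ↥(⋃ i, (F i).carrier)) :
      (M.str.fn s (fun a => Set.inclusion hsub (x a)) : ZFSet) ∈ ⋃ i, (F i).carrier := by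
    obtain ⟨i, hi⟩ := key (τ.fnArity_lt s) x
    obtain ⟨h, h1, -⟩ := K.isSubstr_of_le (hM i)
    have := h1 s fun a => ⟨x a, hi a⟩
    have e : (fun a => Set.inclusion hsub (x a)) =
      fun a => Set.inclusion h (⟨x a, hi a⟩ : (F i).carrier) := rfl
    rw [e, this]
    exact Set.mem_iUnion.2 ⟨i, Subtype.property (Str.fn (F i).str s _)⟩
  let U : Str τ :=
    { carrier := ⋃ i, (F i).carrier
      small := small_subset hsub
      fn := fun s x => ⟨_, hfn s x⟩
      rl := fun r x => M.str.rl r fun a => Set.inclusion hsub (x a) }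
  have hU : U.IsUnion fun i => (F i).str := by
    refine ⟨rfl, fun i => ⟨Set.subset_iUnion (fun i => (F i).carrier) i, ?_, ?_⟩⟩
    · intro s x
      obtain ⟨h, h1, -⟩ := K.isSubstr_of_le (hM i)
      have := congrArg (fun z : M.carrier => (z : ZFSet)) (h1 s x)
      exact Subtype.ext this
    · intro r x
      obtain ⟨h, -, h1⟩ := K.isSubstr_of_le (hM i)
      exact h1 r x
  have hUm := hK.union_mem hι F hF U hU
  exact ⟨⟨U, hUm⟩, hK.union_le hι F hF ⟨U, hUm⟩ hU M hM, rfl⟩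

/-- The union of the images of a `μ`-directed system of `K`-embeddings in a model. -/
theorem exists_union_range (hK : K.IsMuAEC) {ι : Type u} [PartialOrder ι]
    (hι : IsDirectedCard μ ι) {A : ι → K.Model} {M : K.Model} (f : ∀ i, A i ⟶ M)
    (hf : ∀ i j, i ≤ j → Set.range (f i).toFun ⊆ Set.range (f j).toFun) :
    ∃ (N : K.Model) (g : N ⟶ M), Set.range g.toFun = ⋃ i, Set.range (f i).toFun := by
  choose F hF e he hFc using fun i => exists_image (f i)
  have hmono i j (hij : i ≤ j) : F i ≤ F j := by
    refine le_of_subset hK (hF i) (hF j) ?_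
    rw [hFc, hFc]
    rintro _ ⟨x, rfl⟩
    obtain ⟨y, hy⟩ := hf i j hij ⟨x, rfl⟩
    exact ⟨y, congrArg Subtype.val hy⟩
  obtain ⟨N, hN, hNc⟩ := exists_union_le hK hι F hmono M hF
  refine ⟨N, incl hN, ?_⟩
  ext z
  have : z ∈ Set.range (incl hN).toFun ↔ (z : ZFSet) ∈ N.carrier :=
    ⟨by rintro ⟨y, rfl⟩; exact y.2, fun h => ⟨⟨z, h⟩, rfl⟩⟩
  rw [this, hNc]
  simp only [Set.mem_iUnion, hFc, Set.mem_range, Subtype.ext_iff]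

/-- Model-homogeneity with respect to a `K`-embedding instead of an inclusion. -/
theorem IsModelHomogeneous.exists_hom {κ : Cardinal.{u}} {M : K.Model}
    (hM : IsModelHomogeneous κ M) {A B : K.Model} (f : A ⟶ M) (g : A ⟶ B) (hB : B.str.card < κ) :
    ∃ l : B ⟶ M, g ≫ l = f := by
  classical
  obtain ⟨A', hA, e, he, -⟩ := exists_image f
  obtain ⟨B', hB', d, hd, -⟩ := exists_image g
  -- Homogeneity concerns literal inclusions, so `B` is replaced by a copy containing `A'`. With `a`
  -- the set of elements of `A'`, the new points are the pairs `(b, a)`; having rank above that of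
  -- `a`, they avoid `A'`.
  let a : ZFSet.{u} := ZFSet.range fun x : Shrink.{u} A'.carrier =>
    ((equivShrink A'.carrier).symm x : ZFSet)
  have ha (x : ZFSet) (hx : x ∈ A'.carrier) : x ∈ a := by
    simp only [a, ZFSet.mem_range]
    exact ⟨equivShrink _ ⟨x, hx⟩, by simp⟩
  let φ : B.carrier → ZFSet := fun b =>
    if h : ∃ x, g.toFun x = b then (e.toFun h.choose : ZFSet) else ZFSet.pair b a
  have hφg (x : A.carrier) : φ (g.toFun x) = e.toFun x := by
    have h : ∃ y, g.toFun y = g.toFun x := ⟨x, rfl⟩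
    simp only [φ, dif_pos h, Hom.injective g h.choose_spec]
  have hpair (b : ZFSet) : ZFSet.pair b a ∉ A'.carrier := by
    intro h
    have h1 := ZFSet.rank_lt_of_mem (ha _ h)
    have h2 : ZFSet.rank {b, a} < ZFSet.rank (ZFSet.pair b a) :=
      ZFSet.rank_lt_of_mem (by simp [ZFSet.pair])
    have h3 : ZFSet.rank a < ZFSet.rank {b, a} := ZFSet.rank_lt_of_mem (by simp)
    exact (h1.trans (h3.trans h2)).false
  have hφn (b : B.carrier) (h : ¬ ∃ x, g.toFun x = b) : φ b = ZFSet.pair b a := dif_neg h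
  have hφ : Function.Injective φ := by
    intro b c hbc
    by_cases hb : ∃ x, g.toFun x = b <;> by_cases hc : ∃ x, g.toFun x = c
    · obtain ⟨x, rfl⟩ := hb
      obtain ⟨y, rfl⟩ := hc
      rw [hφg, hφg] at hbc
      rw [e.toEquiv.injective (Subtype.ext hbc)]
    · obtain ⟨x, rfl⟩ := hb
      rw [hφg, hφn c hc] at hbc
      exact (hpair c (hbc ▸ Subtype.property _)).elim
    · obtain ⟨y, rfl⟩ := hc
      rw [hφg, hφn b hb] at hbc
      exact (hpair b (hbc ▸ Subtype.property _)).elim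
    · rw [hφn b hb, hφn c hc] at hbc
      exact Subtype.ext (ZFSet.pair_injective hbc).1
  let q := Equiv.ofInjective φ hφ
  let N : K.Model := ⟨B.str.transport q, K.mem_of_iso (B.str.transportIso q) B.mem⟩
  let i : B ≅ N := isoOfStrIso (B.str.transportIso q)
  have hi (b : B.carrier) : (i.hom.toFun b : ZFSet) = φ b := rfl
  have hAN : A' ≤ N := by
    refine K.le_of_iso (d.symm.trans e) (B.str.transportIso q) (fun x y hxy => ?_) hB'
    obtain ⟨z, rfl⟩ := d.toEquiv.surjective x
    have hz : g.toFun z = y := by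
      rw [← hd]
      exact Subtype.ext hxy
    subst hz
    refine Eq.trans ?_ (hφg z).symm
    exact congrArg (fun w => (e.toFun w : ZFSet)) (d.toEquiv.symm_apply_apply z)
  have hBN : N.str.card = B.str.card :=
    Cardinal.mk_congr ((equivShrink _).symm.trans (q.symm.trans (equivShrink _)))
  obtain ⟨k, hk⟩ := hM A' N hA hAN (hBN ▸ hB)
  refine ⟨i.hom ≫ k, hom_ext fun x => Subtype.ext ?_⟩
  have := hk (i.hom.toFun (g.toFun x)) (by rw [hi, hφg]; exact Subtype.property _)
  refine this.trans ?_
  rw [hi, hφg, ← he]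
  rfl

end AbstractClass

end StableIndep

/-! ### Directed hulls and local character. -/

namespace StableIndep

/-- Arbitrarily large regular cardinals `κ₂` such that every subset of size `< κ₂` of a
`κ`-directed poset is contained in a `κ`-directed subset of size `< κ₂`. -/
theorem exists_regular_directed_hull (κ ν : Cardinal.{u}) [hκ : Fact κ.IsRegular] :
    ∃ κ₂ : Cardinal.{u}, κ₂.IsRegular ∧ ν ≤ κ₂ ∧
      ∀ (X : Type u) [PartialOrder X] [IsCardinalFiltered X κ] (A : Set X), HasCardinalLT A κ₂ →
        ∃ B : Set X, A ⊆ B ∧ IsCardinalFiltered B κ ∧ HasCardinalLT B κ₂ := by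
  have hκ₀ : ℵ₀ ≤ κ := hκ.out.aleph0_le
  -- This choice gives `c ^ κ = c`, so a set of size at most `c` has at most `c` subsets of size
  -- less than `κ`. All of them together then serve as the cofinal family, and `κ₂` is the successor
  -- of `c`.
  let c : Cardinal.{u} := 2 ^ max κ ν
  have hc : max κ ν < c := cantor _
  have hc₀ : ℵ₀ ≤ c := hκ₀.trans ((le_max_left _ _).trans hc.le)
  have hcp : c ^ κ = c := by
    rw [← power_mul, mul_eq_left (hκ₀.trans (le_max_left _ _)) (le_max_left _ _)
      (pos_iff_ne_zero.1 (aleph0_pos.trans_le hκ₀))]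
  have hreg : (Order.succ c).IsRegular := isRegular_succ hc₀
  have : Fact (Order.succ c).IsRegular := ⟨hreg⟩
  have hlt : κ < Order.succ c := ((le_max_left _ _).trans_lt hc).trans (Order.lt_succ c)
  refine ⟨Order.succ c, hreg, ((le_max_right _ _).trans hc.le).trans (Order.le_succ c),
    fun X _ _ A hA => SharplyLT.exists_isCardinalFiltered_set_of_exists_cofinal hlt
      (fun Y hY => ⟨Set.univ, ?_, fun x => ⟨x, trivial, le_rfl⟩⟩) A hA⟩
  rw [hasCardinalLT_iff_cardinal_mk_lt, Order.lt_succ_iff] at hY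
  rw [hasCardinalLT_iff_cardinal_mk_lt, Order.lt_succ_iff, mk_univ]
  refine le_trans ?_ ((mk_bounded_set_le Y κ).trans
    ((power_le_power_right (max_le hY hc₀)).trans hcp.le))
  exact mk_subtype_le_of_subset fun A (hA : HasCardinalLT A κ) =>
    ((hasCardinalLT_iff_cardinal_mk_lt _ _).1 hA).le

theorem hasCardinalLT_arrow_of_preorder {X : Type u} [Preorder X] {κ : Cardinal.{u}}
    (hκ : ℵ₀ ≤ κ) (hX : HasCardinalLT X κ) : HasCardinalLT (Arrow X) κ :=
  (hasCardinalLT_prod hκ hX hX).of_injective (fun f : Arrow X => (f.left, f.right))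
    fun f g h => by
      obtain ⟨a, b, f⟩ := f
      obtain ⟨a', b', g⟩ := g
      obtain ⟨rfl, rfl⟩ := Prod.mk.inj h
      congr 1
      exact Subsingleton.elim (α := a ⟶ b) f g

namespace AbstractClass

variable {μ : Cardinal.{u}} {τ : Vocabulary μ} {K : AbstractClass τ}

theorem arrow_exists_lift (hK : K.IsMuAEC) {X N M : Arrow K.Model} (a : X ⟶ M) (j : N ⟶ M)
    (hl : Set.range a.left.toFun ⊆ Set.range j.left.toFun)
    (hr : Set.range a.right.toFun ⊆ Set.range j.right.toFun) : ∃ h : X ⟶ N, h ≫ j = a := by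
  obtain ⟨l, hl⟩ := exists_lift hK a.left j.left hl
  obtain ⟨r, hr⟩ := exists_lift hK a.right j.right hr
  refine ⟨Arrow.homMk l r ?_, Arrow.hom_ext _ _ hl hr⟩
  rw [← cancel_mono j.right, Category.assoc, Category.assoc, hr, ← Arrow.w j, reassoc_of% hl,
    Arrow.w a]

theorem arrow_comp_cancel {X N M : Arrow K.Model} {a b : X ⟶ N} (j : N ⟶ M)
    (h : a ≫ j = b ≫ j) : a = b := by
  ext
  · rw [← cancel_mono j.left]; exact congrArg CommaMorphism.left h
  · rw [← cancel_mono j.right]; exact congrArg CommaMorphism.right h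

variable {I : IndepRel K.Model} (hT : I.RightTransitive) (hE : I.HasExistence)

/-- The arrow underlying an object of `NF`. -/
def nfObj (X : I.NF hT hE) : Arrow K.Model :=
  haveI := IndepRel.nf_isMultiplicative hT hE
  WideSubcategory.obj X

/-- An arrow as an object of `NF`. -/
def nfMk (X : Arrow K.Model) : I.NF hT hE :=
  haveI := IndepRel.nf_isMultiplicative hT hE
  ⟨X⟩

/-- The underlying morphism of arrows of a morphism of `NF`. -/
def nfHom {X Y : I.NF hT hE} (f : X ⟶ Y) : nfObj hT hE X ⟶ nfObj hT hE Y :=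
  haveI := IndepRel.nf_isMultiplicative hT hE
  InducedWideCategory.Hom.hom f

theorem nf_nfHom {X Y : I.NF hT hE} (f : X ⟶ Y) : I.nf (nfHom hT hE f) :=
  haveI := IndepRel.nf_isMultiplicative hT hE
  InducedWideCategory.Hom.property f

theorem exists_nfHom {X Y : I.NF hT hE} (h : nfObj hT hE X ⟶ nfObj hT hE Y) (hh : I.nf h) :
    ∃ f : X ⟶ Y, nfHom hT hE f = h :=
  haveI := IndepRel.nf_isMultiplicative hT hE
  ⟨InducedWideCategory.Hom.mk h hh, rfl⟩

theorem nfHom_comp {X Y Z : I.NF hT hE} (f : X ⟶ Y) (g : Y ⟶ Z) :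
    nfHom hT hE (f ≫ g) = nfHom hT hE f ≫ nfHom hT hE g := rfl

theorem nfHom_ext {X Y : I.NF hT hE} {f g : X ⟶ Y} (h : nfHom hT hE f = nfHom hT hE g) :
    f = g :=
  haveI := IndepRel.nf_isMultiplicative hT hE
  InducedWideCategory.Hom.ext h

/-- The square `j` is not assumed independent: left cancellation of `nf` makes the lift independent
because `a` is. -/
theorem nf_exists_lift (hK : K.IsMuAEC) (hU : I.HasUniqueness) {X N M : I.NF hT hE} (a : X ⟶ M)
    (j : nfObj hT hE N ⟶ nfObj hT hE M)
    (hl : Set.range (nfHom hT hE a).left.toFun ⊆ Set.range j.left.toFun)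
    (hr : Set.range (nfHom hT hE a).right.toFun ⊆ Set.range j.right.toFun) :
    ∃ h : X ⟶ N, nfHom hT hE h ≫ j = nfHom hT hE a := by
  obtain ⟨h, hh⟩ := arrow_exists_lift hK (nfHom hT hE a) j hl hr
  obtain ⟨f, rfl⟩ := exists_nfHom hT hE h
    (IndepRel.nf_of_comp hT hE hU h j (hh ▸ nf_nfHom hT hE a))
  exact ⟨f, hh⟩

/-- Local character: every element of the target of an arrow lies in the image of an independent
square from an arrow belonging to a fixed small family. -/
theorem exists_small_cover (hK : K.IsMuAEC) (hU : I.HasUniqueness)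
    [hacc : IsAccessibleCategory.{u} (I.NF hT hE)] :
    ∃ (Q : ObjectProperty (I.NF hT hE)) (_ : ObjectProperty.Small.{u} Q),
      ∀ (M : I.NF hT hE) (x : (nfObj hT hE M).right.carrier), ∃ (X : I.NF hT hE) (_ : Q X) (f : X ⟶ M),
        x ∈ Set.range (nfHom hT hE f).right.toFun := by
  obtain ⟨κ, hκ, hacc⟩ := hacc.exists_cardinal
  obtain ⟨P, hPs, hP⟩ := HasCardinalFilteredGenerator.exists_generator (I.NF hT hE) κ
  obtain ⟨κ₂, hκ₂, hμκ, hull⟩ := exists_regular_directed_hull κ μ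
  -- The closure of the generator under colimits of size less than `κ₂` is essentially small; `Q` is
  -- a small set of representatives.
  obtain ⟨Q, hQs, -, hQ⟩ := ObjectProperty.EssentiallySmall.exists_small_le.{u}
    (P.colimitsCardinalClosure κ₂)
  refine ⟨Q, hQs, fun M x => ?_⟩
  suffices h : ∃ (X : I.NF hT hE) (_ : P.colimitsCardinalClosure κ₂ X) (f : X ⟶ M),
      x ∈ Set.range (nfHom hT hE f).right.toFun by
    obtain ⟨X, hX, f, y, hy⟩ := h
    obtain ⟨Y, hY, ⟨e⟩⟩ := hQ X hX
    refine ⟨Y, hY, e.inv ≫ f, (nfHom hT hE e.hom).right.toFun y, ?_⟩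
    have : f = e.hom ≫ e.inv ≫ f := by simp
    rw [← hy]
    conv_rhs => rw [this]
    rfl
  obtain ⟨J', _, _, ⟨p'⟩⟩ := hP.exists_colimitsOfShape M
  obtain ⟨J, _, _, G, _⟩ := IsCardinalFiltered.exists_cardinal_directed J' κ
  let p := p'.reindex G
  -- `M` is a `κ`-directed colimit of generators, but `κ` may be too small for the chain axioms. The
  -- `κ`-directed subsets of `J` of size less than `κ₂` form a `μ`-directed poset, and each has a
  -- colimit `D S` in `C_NF`.
  let T : Type u := {S : Set J // IsCardinalFiltered S κ ∧ HasCardinalLT S κ₂}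
  have hTd : IsDirectedCard μ T := by
    intro s hs
    have : HasCardinalLT (⋃ S : s, (S.1.1 : Set J)) κ₂ := by
      have : Fact κ₂.IsRegular := ⟨hκ₂⟩
      exact hasCardinalLT_iUnion _
        ((hasCardinalLT_iff_cardinal_mk_lt _ _).2 (hs.trans_le hμκ)) fun S => S.1.2.2
    obtain ⟨B, hB, hB1, hB2⟩ := hull J _ this
    exact ⟨⟨B, hB1, hB2⟩, fun S hS => (Set.subset_iUnion (fun S : s => S.1.1) ⟨S, hS⟩).trans hB⟩
  have hmem (i : J) : ∃ S : T, i ∈ S.1 := by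
    obtain ⟨B, hB, hB1, hB2⟩ := hull J {i} (hasCardinalLT_of_finite _ _ hκ₂.aleph0_le)
    exact ⟨⟨B, hB1, hB2⟩, hB rfl⟩
  let inc (S : T) : S.1 ⥤ J := 
    { obj := fun i => i.1, map := fun f => homOfLE (leOfHom f) }
  have hcol (S : T) : HasColimit (inc S ⋙ p.diag) := by
    have := S.2.1
    have := HasCardinalFilteredColimits.hasColimitsOfShape (κ := κ) (I.NF hT hE) S.1
    infer_instance
  let D (S : T) : I.NF hT hE := colimit (inc S ⋙ p.diag)
  have hD (S : T) : P.colimitsCardinalClosure κ₂ (D S) := by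
    have := P.isClosedUnderColimitsOfShape_colimitsCardinalClosure κ₂ S.1
      (hasCardinalLT_arrow_of_preorder hκ₂.aleph0_le S.2.2)
    exact ObjectProperty.prop_colimit _ _ fun i =>
      P.le_colimitsCardinalClosure κ₂ _ (p.prop_diag_obj _)
  let φ (S : T) : D S ⟶ M := colimit.desc (inc S ⋙ p.diag)
    ⟨M, { app := fun i => p.ι.app i.1, naturality := fun i j f => by simp [inc] }⟩
  have hφ (S : T) (i : S.1) : colimit.ι (inc S ⋙ p.diag) i ≫ φ S = p.ι.app i.1 := by simp [φ]
  have hle (S S' : T) (h : S ≤ S') : ∃ g : D S ⟶ D S', g ≫ φ S' = φ S := by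
    refine ⟨colimit.desc (inc S ⋙ p.diag) ⟨D S', {
      app := fun i => colimit.ι (inc S' ⋙ p.diag) ⟨i.1, h i.2⟩
      naturality := fun i j f => ?_ }⟩, ?_⟩
    · have hf : (⟨i.1, h i.2⟩ : S'.1) ≤ ⟨j.1, h j.2⟩ := leOfHom f
      exact (colimit.w (inc S' ⋙ p.diag) (homOfLE hf)).trans (Category.comp_id _).symm
    · refine colimit.hom_ext fun i => ?_
      rw [hφ, ← Category.assoc, colimit.ι_desc]
      exact hφ S' ⟨i.1, h i.2⟩
  have hrange {X Y Z : I.NF hT hE} (f : X ⟶ Y) (g : Y ⟶ Z) :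
      Set.range (nfHom hT hE (f ≫ g)).left.toFun ⊆ Set.range (nfHom hT hE g).left.toFun ∧
      Set.range (nfHom hT hE (f ≫ g)).right.toFun ⊆ Set.range (nfHom hT hE g).right.toFun :=
    ⟨by rintro _ ⟨y, rfl⟩; exact ⟨(nfHom hT hE f).left.toFun y, rfl⟩,
      by rintro _ ⟨y, rfl⟩; exact ⟨(nfHom hT hE f).right.toFun y, rfl⟩⟩
  -- The images of the `D S` in `M` are united in `K`, on the source and on the target side. This
  -- gives a subarrow `N` of `M` whose inclusion `j` is not known to be independent.
  obtain ⟨N₀, j₀, hj₀⟩ := exists_union_range hK hTd (fun S => (nfHom hT hE (φ S)).left)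
    fun S S' h => by
      obtain ⟨g, hg⟩ := hle S S' h
      exact hg ▸ (hrange g _).1
  obtain ⟨N₁, j₁, hj₁⟩ := exists_union_range hK hTd (fun S => (nfHom hT hE (φ S)).right)
    fun S S' h => by
      obtain ⟨g, hg⟩ := hle S S' h
      exact hg ▸ (hrange g _).2
  obtain ⟨n, hn⟩ := exists_lift hK (j₀ ≫ (nfObj hT hE M).hom) j₁ (by
    rintro _ ⟨y, rfl⟩
    obtain ⟨S, z, hz⟩ := Set.mem_iUnion.1 (hj₀ ▸ Set.mem_range_self y)
    rw [hj₁]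
    refine Set.mem_iUnion.2 ⟨S, (nfObj hT hE (D S)).hom.toFun z, ?_⟩
    rw [comp_toFun, ← hz]
    exact congrArg (fun k => Hom.toFun k z) (Arrow.w (nfHom hT hE (φ S))).symm)
  let N : I.NF hT hE := nfMk hT hE (Arrow.mk n)
  let j : nfObj hT hE N ⟶ nfObj hT hE M := Arrow.homMk j₀ j₁ hn.symm
  have hlS (S : T) : ∃ l : D S ⟶ N, nfHom hT hE l ≫ j = nfHom hT hE (φ S) :=
    nf_exists_lift hT hE hK hU (φ S) j (hj₀ ▸ Set.subset_iUnion_of_subset S le_rfl)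
      (hj₁ ▸ Set.subset_iUnion_of_subset S le_rfl)
  choose lS hlS using hlS
  have hl (i : J) : ∃ l : p.diag.obj i ⟶ N, nfHom hT hE l ≫ j = nfHom hT hE (p.ι.app i) := by
    obtain ⟨S, hS⟩ := hmem i
    refine ⟨colimit.ι (inc S ⋙ p.diag) ⟨i, hS⟩ ≫ lS S, ?_⟩
    rw [nfHom_comp, Category.assoc, hlS, ← nfHom_comp, hφ]
  choose l hl using hl
  -- The maps into `M` factor through `N` by independent squares, forming a cocone in `C_NF`; the
  -- colimit property of `M` then gives `h`.
  let h : M ⟶ N := p.isColimit.desc ⟨N, {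
    app := l
    naturality := fun i i' f => by
      apply nfHom_ext
      apply arrow_comp_cancel j
      refine Eq.trans ?_ (congrArg (· ≫ j) (congrArg (nfHom hT hE) (Category.comp_id (l i)).symm))
      rw [nfHom_comp, Category.assoc, hl, hl, ← nfHom_comp, p.w] }⟩
  have hh (i : J) : p.ι.app i ≫ h = l i := p.isColimit.fac _ i
  have hφh (S : T) : φ S ≫ h = lS S := by
    refine colimit.hom_ext fun i => ?_
    rw [← Category.assoc, hφ, hh]
    apply nfHom_ext
    apply arrow_comp_cancel j
    rw [hl, nfHom_comp, Category.assoc, hlS, ← nfHom_comp, hφ]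
  -- `h` followed by `j` fixes the image of each `D S`, but uniqueness of maps out of `M` cannot
  -- show it is the identity, since `j` may lie outside `C_NF`. Injectivity suffices: `r x` lies in
  -- the union, so it is some `φ S z`, which `r` fixes, and `r x = r (φ S z)` forces `x = φ S z`.
  let r : (nfObj hT hE M).right ⟶ (nfObj hT hE M).right := (nfHom hT hE h ≫ j).right
  obtain ⟨S, z, hz⟩ := Set.mem_iUnion.1
    (hj₁ ▸ Set.mem_range_self ((nfHom hT hE h).right.toFun x) : r.toFun x ∈ ⋃ S, _)
  refine ⟨D S, hD S, φ S, z, Hom.injective r (Eq.trans ?_ hz)⟩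
  have : nfHom hT hE (φ S) ≫ nfHom hT hE h ≫ j = nfHom hT hE (φ S) := by
    rw [← Category.assoc, ← nfHom_comp, hφh, hlS]
  exact congrArg (fun k => Hom.toFun (CommaMorphism.right k) z) this

end AbstractClass

end StableIndep

/-! ### Disjointness over homogeneous bases, and pullbacks. -/

namespace StableIndep

namespace AbstractClass

variable {μ : Cardinal.{u}} {τ : Vocabulary μ} {K : AbstractClass τ}

/-- Equivalent amalgams identify the same elements. -/
theorem sim_identifies {M₀ M₁ M₂ : K.Model} {f₁ : M₀ ⟶ M₁} {f₂ : M₀ ⟶ M₂} {a b : Amalgam f₁ f₂}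
    (h : a.Sim b) (x : M₁.carrier) (y : M₂.carrier) (hxy : a.inl.toFun x = a.inr.toFun y) :
    b.inl.toFun x = b.inr.toFun y := by
  have step (a b : Amalgam f₁ f₂) (h : a.SimStar b) (hxy : a.inl.toFun x = a.inr.toFun y) :
      b.inl.toFun x = b.inr.toFun y := by
    obtain ⟨N, ga, gb, h1, h2⟩ := h
    apply Hom.injective gb
    rw [← comp_toFun, ← comp_toFun, ← h1, ← h2, comp_toFun, comp_toFun, hxy]
  induction h with
  | single h => exact step _ _ h hxy
  | tail _ h ih => exact step _ _ h ih

theorem powerlt_mono_base {a b : Cardinal.{u}} (c : Cardinal.{u}) (h : a ≤ b) :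
    a ^< c ≤ b ^< c :=
  powerlt_le.2 fun _ hx => (power_le_power_right h).trans (le_powerlt _ hx)

/-- Strong submodels containing the image of a `K`-embedding and an additional element. -/
theorem IsLST.exists_le {θ : Cardinal.{u}} (hθ : K.IsLST θ) {A M : K.Model} (f : A ⟶ M)
    (z : M.carrier) : ∃ (N : K.Model) (h : N ≤ M), Set.range f.toFun ⊆ Set.range (incl h).toFun ∧
      z ∈ Set.range (incl h).toFun ∧ N.str.card ≤ (A.str.card + 1) ^< μ + θ := by
  obtain ⟨N, hN, hs, hc⟩ := hθ.2.2 M (insert z (Set.range f.toFun))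
  refine ⟨N, hN, ?_, ⟨⟨z, hs z (Set.mem_insert _ _)⟩, rfl⟩,
    hc.trans (add_le_add_left (powerlt_mono_base μ ?_) θ)⟩
  · rintro _ ⟨x, rfl⟩
    exact ⟨⟨f.toFun x, hs _ (Set.mem_insert_of_mem _ ⟨x, rfl⟩)⟩, rfl⟩
  · rw [Str.card, ← mk_option]
    let g : Option (Shrink.{u} A.carrier) → Shrink.{u} ↥(insert z (Set.range f.toFun)) := fun o =>
      equivShrink _ (o.elim ⟨z, Set.mem_insert _ _⟩
        fun x => ⟨f.toFun ((equivShrink _).symm x), Set.mem_insert_of_mem _ ⟨_, rfl⟩⟩)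
    refine mk_le_of_surjective (f := g) fun w => ?_
    obtain ⟨⟨w, hw⟩, rfl⟩ := (equivShrink _).surjective w
    rcases hw with rfl | ⟨x, rfl⟩
    · exact ⟨none, rfl⟩
    · exact ⟨some (equivShrink _ x), by simp [g]⟩

/-- There is a threshold above which independent squares over model-homogeneous bases are
disjoint. -/
theorem exists_disjoint (hK : K.IsMuAEC) {I : IndepRel K.Model} (hU : I.HasUniqueness)
    (hI : IndepRel.RightAccessible.{u} I) :
    ∃ κ : Cardinal.{u}, κ.IsRegular ∧ K.LS < κ ∧
      ∀ (M₀ M₁ M₂ M₃ : K.Model) (f₁ : M₀ ⟶ M₁) (f₂ : M₀ ⟶ M₂) (g₁ : M₁ ⟶ M₃) (g₂ : M₂ ⟶ M₃),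
        I.Indep f₁ f₂ g₁ g₂ → IsModelHomogeneous κ M₀ →
        ∀ y z, g₁.toFun y = g₂.toFun z → y ∈ Set.range f₁.toFun := by
  obtain ⟨hT, hE, hacc⟩ := hI
  obtain ⟨Q, hQ, hcov⟩ := exists_small_cover hT hE hK hU
  obtain ⟨θ, hθ⟩ := hK.lst
  have hQ' : Small.{u} (Subtype Q) := hQ
  let b : Shrink.{u} (Subtype Q) → Cardinal.{u} := fun q =>
    (nfObj hT hE ((equivShrink _).symm q).1).left.str.card
  have hb (X) (hX : Q X) : (nfObj hT hE X).left.str.card ≤ iSup b := by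
    have := le_ciSup (bddAbove_of_small (s := Set.range b)) (equivShrink _ ⟨X, hX⟩)
    simpa [b] using this
  -- `c` bounds the size of a strong submodel generated by one point and the image of a covering
  -- arrow's source. The `ℵ₀` makes the successor regular, and the summand `θ` puts it above `K.LS`.
  let c : Cardinal.{u} := max ℵ₀ ((iSup b + 1) ^< μ + θ)
  have hc : K.LS ≤ c :=
    (csInf_le' (s := {θ | K.IsLST θ}) hθ).trans ((self_le_add_left _ _).trans (le_max_right _ _))
  refine ⟨Order.succ c, isRegular_succ (le_max_left _ _), Order.lt_succ_of_le hc, ?_⟩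
  intro M₀ M₁ M₂ M₃ f₁ f₂ g₁ g₂ hind hM₀ y z hyz
  obtain ⟨X, hX, f, y', rfl⟩ := hcov (nfMk hT hE (Arrow.mk f₁)) y
  have hX' := hb X hX
  have h₁ : I.Indep (nfObj hT hE X).hom (nfHom hT hE f).left (nfHom hT hE f).right f₁ :=
    nf_nfHom hT hE f
  generalize (nfHom hT hE f).left = a at *
  generalize (nfHom hT hE f).right = r at *
  generalize (nfObj hT hE X).hom = k at *
  generalize (nfObj hT hE X).left = A₀ at *
  generalize (nfObj hT hE X).right = A₁ at *
  obtain ⟨N, hN, hN₁, ⟨z, rfl⟩, hN₂⟩ := hθ.exists_le (a ≫ f₂) z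
  obtain ⟨e, he⟩ := exists_lift hK (a ≫ f₂) (incl hN) hN₁
  have hNc : N.str.card < Order.succ c := Order.lt_succ_of_le (hN₂.trans
    ((add_le_add_left (powerlt_mono_base μ (add_le_add_left hX' 1)) θ).trans (le_max_right _ _)))
  -- `l` copies `N` into `M₀` over `A₀`. Both `s₁`, in `M₃`, and `s₂`, in `M₁`, then amalgamate the
  -- span `(k, e)` independently.
  obtain ⟨l, hl⟩ := hM₀.exists_hom a e hNc
  have s₁ : I.Indep k e (r ≫ g₁) (incl hN ≫ g₂) := by
    apply IndepRel.indep_right_mono hT hE hU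
    rw [he]
    exact hT h₁ hind
  have s₂ : I.Indep k e r (l ≫ f₁) := by
    apply IndepRel.indep_right_mono hT hE hU
    rwa [hl]
  -- The first amalgam identifies `y'` with `z`, so the second does too: `r y' = f₁ (l z)`.
  have := sim_identifies (hU ⟨_, _, _, I.comm s₁⟩ ⟨_, _, _, I.comm s₂⟩ s₁ s₂) y' z hyz
  exact ⟨l.toFun z, this.symm⟩

/-- A commutative square of `K`-embeddings which is a pullback on universes is a pullback. -/
theorem isPullback_of_disjoint (hK : K.IsMuAEC) {M₀ M₁ M₂ M₃ : K.Model} {f₁ : M₀ ⟶ M₁}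
    {f₂ : M₀ ⟶ M₂} {g₁ : M₁ ⟶ M₃} {g₂ : M₂ ⟶ M₃} (hc : f₁ ≫ g₁ = f₂ ≫ g₂)
    (h : ∀ y z, g₁.toFun y = g₂.toFun z → y ∈ Set.range f₁.toFun) :
    IsPullback f₁ f₂ g₁ g₂ := by
  have hl (s : PullbackCone g₁ g₂) : ∃ l : s.pt ⟶ M₀, l ≫ f₁ = s.fst :=
    exists_lift hK s.fst f₁ (by
      rintro _ ⟨x, rfl⟩
      exact h _ (s.snd.toFun x) (congrArg (fun k => Hom.toFun k x) s.condition))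
  choose l hl using hl
  refine ⟨⟨hc⟩, ⟨PullbackCone.IsLimit.mk hc l hl (fun s => ?_) fun s m hm _ => ?_⟩⟩
  -- The lift was built against `f₁` alone; its compatibility with `f₂` follows because `g₂` is
  -- mono.
  · rw [← cancel_mono g₂, Category.assoc, ← hc, reassoc_of% hl s, s.condition]
  · rw [← cancel_mono f₁, hm, hl]

end AbstractClass

end StableIndep

/-! ### The main theorem. -/

theorem mainTheorem9 {μ : Cardinal.{u}} (hμ : μ.IsRegular)
    {τ : StableIndep.Vocabulary.{u} μ} (K : StableIndep.AbstractClass.{u} τ) (hK : K.IsMuAEC)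
    (I : StableIndep.IndepRel K.Model) (hI : StableIndep.IndepRel.IsStable.{u} I) :
    ∃ κ : Cardinal.{u}, κ.IsRegular ∧ K.LS < κ ∧
      (∀ M₀ M₁ M₂ M₃ : K.Model,
        StableIndep.AbstractClass.IndepIn I M₀ M₁ M₂ M₃ →
        StableIndep.AbstractClass.IsModelHomogeneous κ M₀ →
        M₁.carrier ∩ M₂.carrier = M₀.carrier) ∧
      (∀ (M₀ M₁ M₂ M₃ : K.Model) (f₁ : M₀ ⟶ M₁) (f₂ : M₀ ⟶ M₂) (g₁ : M₁ ⟶ M₃) (g₂ : M₂ ⟶ M₃),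
        I.Indep f₁ f₂ g₁ g₂ →
        StableIndep.AbstractClass.IsModelHomogeneous κ M₀ →
        CategoryTheory.IsPullback f₁ f₂ g₁ g₂) := by
  obtain ⟨κ, hκ, hLS, h⟩ :=
    StableIndep.AbstractClass.exists_disjoint hK hI.uniqueness hI.rightAccessible
  refine ⟨κ, hκ, hLS, ?_, fun M₀ M₁ M₂ M₃ f₁ f₂ g₁ g₂ hind hM =>
    StableIndep.AbstractClass.isPullback_of_disjoint hK (I.comm hind)
      (h M₀ M₁ M₂ M₃ f₁ f₂ g₁ g₂ hind hM)⟩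
  rintro M₀ M₁ M₂ M₃ ⟨h₀₁, h₀₂, h₁₃, h₂₃, hind⟩ hM
  refine Set.Subset.antisymm ?_
    (Set.subset_inter (K.isSubstr_of_le h₀₁).1 (K.isSubstr_of_le h₀₂).1)
  rintro x ⟨hx₁, hx₂⟩
  -- For inclusions, a common element `x` gives two points with literally the same image in `M₃`.
  obtain ⟨w, hw⟩ := h _ _ _ _ _ _ _ _ hind hM ⟨x, hx₁⟩ ⟨x, hx₂⟩ rfl
  have : (w : ZFSet) = x := congrArg Subtype.val hw
  exact this ▸ w.2
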